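/- For a positive integer $n$ let $\mathbb{P}_n$ be the set of positive definite complex $n\times n$ matrices, with real powers $A^p$ and $\log A$ of $A\in\mathbb{P}_n$ given by functional calculus, and let $\le$ be the Loewner order on Hermitian matrices ($X\le Y$ iff $Y-X$ is positive semidefinite). For $A,B\in\mathbb{P}_n$ and $p\in\mathbb{R}$ define the $p$-power mean $$M_p(A,B)=\Bigl(\frac{A^p+B^p}{2}\Bigr)^{1/p}\ \ (p\neq 0),\qquad M_0(A,B)=\exp\Bigl(\frac{\log A+\log B}{2}\Bigr).$$ **Theorem.** Let $p,q\in\mathbb{R}$, and assume that $M_p(A,B)\le M_q(A,B)$ for all $A,B\in\mathbb{P}_2$. Then $(p,q)$ satisfies at least one of the following conditions: 1. $p=q$; 2. $1\le p<q$; 3. $p<q\le-1$; 4. $p\le-1$ and $q\ge1$; 5. $1/2\le p<1\le q$; 6. $p\le-1<q\le-1/2$. -/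

import Mathlib

open scoped ComplexOrder MatrixOrder

noncomputable section

/-- The real power `A ^ p` of a Hermitian matrix (meant for positive definite `A`), by the continuous
functional calculus: apply `t ↦ t ^ p` to the eigenvalues of `A`. -/
def matPow {n : Type*} [Fintype n] [DecidableEq n] (A : Matrix n n ℂ) (p : ℝ) : Matrix n n ℂ :=
  cfc (fun t : ℝ => t ^ p) A

/-- The logarithm of a positive definite matrix, by the continuous functional calculus. -/
def matLog {n : Type*} [Fintype n] [DecidableEq n] (A : Matrix n n ℂ) : Matrix n n ℂ :=
  cfc Real.log A

/-- The exponential of a Hermitian matrix, by the continuous functional calculus. -/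
def matExp {n : Type*} [Fintype n] [DecidableEq n] (A : Matrix n n ℂ) : Matrix n n ℂ :=
  cfc Real.exp A

/-- The `p`-power mean of two positive definite matrices: `((A ^ p + B ^ p) / 2) ^ (1 / p)` for
`p ≠ 0`, and the Log-Euclidean mean `exp ((log A + log B) / 2)` for `p = 0`. -/
def powerMean {n : Type*} [Fintype n] [DecidableEq n] (p : ℝ) (A B : Matrix n n ℂ) :
    Matrix n n ℂ :=
  if p = 0 then matExp ((1 / 2 : ℝ) • (matLog A + matLog B))
  else matPow ((1 / 2 : ℝ) • (matPow A p + matPow B p)) (1 / p)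

end

/-! Commuting matrices already force p ≤ q: compare the means of 2 and y as y → ∞. For p < q it
remains to show q ≤ -1/2 or q ≥ 1 (`le_or_ge_of_powerMean_le`); inversion exchanges (p, q) with (-q,
-p), which gives p ≥ 1/2 or p ≤ -1, and the cases combine.

The obstruction uses A and B with common lowest eigenvalue 1, other eigenvalues x > y > 1, and
lowest eigenvectors whose Bloch vectors a, b have inner product 1 - ε. With X_q = (x^q - 1)/q and
Y_q = (y^q - 1)/q, the lowest eigenvector of M_q points along X_q a + Y_q b, a direction governed by
the weight w_q = Y_q/(X_q + Y_q). At that vector M_q exceeds 1 by at most Y_q ε/2, while M_p, whose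
lowest eigenvector is tilted away, exceeds 1 by at least (y - 1)(w_p - w_q)² ε/4. Hence (y - 1)(w_p
- w_q)² ≤ 2 Y_q (`mul_sq_sub_le_of_powerMean_le`).

Let y → ∞ with x = 2y or x = y². For 0 ≤ q < 1, Y_q = o(y), so the weights must have equal limits,
and they do not. For -1/2 < q < 0, Y_q is bounded but the left side grows like y^(1 + 2q). The pair
p = 0 < q < 1 is dual to one with q = 0. -/

/-! ### Functional calculus and inversion of means. -/

section FunctionalCalculus

variable {n : Type*} [Fintype n] [DecidableEq n]

theorem continuousOn_real_spectrum (f : ℝ → ℝ) (A : Matrix n n ℂ) :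
    ContinuousOn f (spectrum ℝ A) :=
  Matrix.finite_real_spectrum.continuousOn f

/-- Functional calculus of a real combination of `1` and a self-adjoint involution. -/
theorem cfc_smul_one_add_smul_involution (f : ℝ → ℝ) {J : Matrix n n ℂ} (hJ : J.IsHermitian)
    (hJJ : J * J = 1) (t r : ℝ) :
    cfc f (t • (1 : Matrix n n ℂ) + r • J) =
      ((f (t + r) + f (t - r)) / 2) • (1 : Matrix n n ℂ) + ((f (t + r) - f (t - r)) / 2) • J := by
  have hJ' : IsSelfAdjoint J := hJ
  have hone : IsSelfAdjoint (1 : Matrix n n ℂ) := IsSelfAdjoint.one _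
  rcases eq_or_ne r 0 with rfl | hr
  · have := cfc_algebraMap (A := Matrix n n ℂ) t f
    simpa [Algebra.algebraMap_eq_smul_one] using this
  set A := t • (1 : Matrix n n ℂ) + r • J with hA
  have hAsa : IsSelfAdjoint A := ((IsSelfAdjoint.all t).smul hone).add ((IsSelfAdjoint.all r).smul hJ')
  have hspec : ∀ z ∈ spectrum ℝ A, z = t + r ∨ z = t - r := by
    intro z hz
    -- A is a root of (z - t)² - r², so its spectrum lies in {t + r, t - r}.
    have h1 := spectrum.subset_polynomial_aeval A
      ((Polynomial.X - Polynomial.C t) ^ 2 - Polynomial.C (r ^ 2)) ⟨z, hz, rfl⟩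
    have h2 : Polynomial.aeval A
        ((Polynomial.X - Polynomial.C t) ^ 2 - Polynomial.C (r ^ 2)) = 0 := by
      simp [hA, Algebra.algebraMap_eq_smul_one, pow_two, hJJ, smul_smul]
    rw [h2] at h1
    have h3 : (z - t) ^ 2 - r ^ 2 = 0 := by
      rcases subsingleton_or_nontrivial (Matrix n n ℂ) with h | h
      · simp at h1
      · simpa using h1
    have h4 : (z - (t + r)) * (z - (t - r)) = 0 := by linear_combination h3
    rcases mul_eq_zero.mp h4 with h | h
    · left; linarith
    · right; linarith
  -- On two points f agrees with its affine interpolant a + b z.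
  set b := (f (t + r) - f (t - r)) / (2 * r) with hb
  set a := (f (t + r) + f (t - r)) / 2 - b * t with ha
  have hcongr : cfc f A = cfc (fun z => a + b * z) A := by
    apply cfc_congr
    intro z hz
    rcases hspec z hz with rfl | rfl <;> simp only [ha, hb] <;> field_simp <;> ring
  rw [hcongr, cfc_const_add a _ A (by fun_prop) hAsa, cfc_const_mul_id b A hAsa,
    Algebra.algebraMap_eq_smul_one, hA, smul_add, smul_smul, smul_smul, ← add_assoc, ← add_smul]
  congr 2
  · rw [ha]; ring
  · rw [hb]; field_simp

theorem spectrum_pos_of_posDef {A : Matrix n n ℂ} (hA : A.PosDef) {z : ℝ}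
    (hz : z ∈ spectrum ℝ A) : 0 < z :=
  hA.isStrictlyPositive.spectrum_pos hz

theorem posDef_cfc {A : Matrix n n ℂ} (hA : A.PosDef) {f : ℝ → ℝ} (hf : ∀ z, 0 < z → 0 < f z) :
    (cfc f A).PosDef := by
  refine Matrix.isStrictlyPositive_iff_posDef.mp ?_
  exact (cfc_isStrictlyPositive_iff f A (continuousOn_real_spectrum _ _) hA.1).mpr
    fun z hz => hf z (spectrum_pos_of_posDef hA hz)

theorem inv_cfc {A : Matrix n n ℂ} (hA : A.IsHermitian) {f : ℝ → ℝ}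
    (hf : ∀ z ∈ spectrum ℝ A, f z ≠ 0) : (cfc f A)⁻¹ = cfc (fun z => (f z)⁻¹) A := by
  rw [Matrix.nonsing_inv_eq_ringInverse]
  exact (cfc_inv f A hf (continuousOn_real_spectrum _ _) hA).symm

theorem cfc_inv_left {A : Matrix n n ℂ} (hA : A.PosDef) (f : ℝ → ℝ) :
    cfc f A⁻¹ = cfc (fun z => f z⁻¹) A := by
  have h : A⁻¹ = cfc (fun z : ℝ => z⁻¹) A := by
    conv_lhs => rw [← cfc_id ℝ A hA.1]
    exact inv_cfc hA.1 fun z hz => (spectrum_pos_of_posDef hA hz).ne'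
  rw [h]
  exact (cfc_comp' f (fun z => z⁻¹) A ((Matrix.finite_real_spectrum.image _).continuousOn f)
    (continuousOn_real_spectrum _ _) hA.1).symm

theorem matPow_inv {A : Matrix n n ℂ} (hA : A.PosDef) (p : ℝ) :
    matPow A⁻¹ p = matPow A (-p) := by
  rw [matPow, matPow, cfc_inv_left hA]
  refine cfc_congr fun z hz => ?_
  have := spectrum_pos_of_posDef hA hz
  rw [Real.inv_rpow this.le, Real.rpow_neg this.le]

theorem matLog_inv {A : Matrix n n ℂ} (hA : A.PosDef) : matLog A⁻¹ = -matLog A := by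
  rw [matLog, matLog, cfc_inv_left hA, ← cfc_neg]
  exact cfc_congr fun z _ => Real.log_inv z

theorem posDef_matPow {A : Matrix n n ℂ} (hA : A.PosDef) (p : ℝ) : (matPow A p).PosDef :=
  posDef_cfc hA fun _ hz => Real.rpow_pos_of_pos hz p

omit [Fintype n] [DecidableEq n] in
theorem posDef_half_smul_add {A B : Matrix n n ℂ} (hA : A.PosDef) (hB : B.PosDef) :
    ((1 / 2 : ℝ) • (A + B)).PosDef :=
  (hA.add hB).smul (by norm_num)

theorem isSelfAdjoint_half_smul_matLog_add (A B : Matrix n n ℂ) :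
    IsSelfAdjoint ((1 / 2 : ℝ) • (matLog A + matLog B)) :=
  (IsSelfAdjoint.all _).smul ((cfc_predicate Real.log A).add (cfc_predicate Real.log B))

theorem posDef_powerMean {A B : Matrix n n ℂ} (hA : A.PosDef) (hB : B.PosDef) (p : ℝ) :
    (powerMean p A B).PosDef := by
  unfold powerMean
  split_ifs
  · have hsa := isSelfAdjoint_half_smul_matLog_add A B
    exact Matrix.isStrictlyPositive_iff_posDef.mp
      ((cfc_isStrictlyPositive_iff Real.exp _ (continuousOn_real_spectrum _ _) hsa).mpr
        fun z _ => Real.exp_pos z)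
  · exact posDef_matPow (posDef_half_smul_add (posDef_matPow hA p) (posDef_matPow hB p)) _

theorem powerMean_neg {A B : Matrix n n ℂ} (hA : A.PosDef) (hB : B.PosDef) (p : ℝ) :
    powerMean (-p) A B = (powerMean p A⁻¹ B⁻¹)⁻¹ := by
  unfold powerMean
  simp only [neg_eq_zero]
  split_ifs with hp
  · have hsa := isSelfAdjoint_half_smul_matLog_add A B
    rw [matLog_inv hA, matLog_inv hB, ← neg_add, smul_neg, matExp, matExp,
      inv_cfc hsa.neg (fun z _ => (Real.exp_pos z).ne')]
    refine Eq.trans ?_ (cfc_comp_neg (fun z => (Real.exp z)⁻¹) _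
      ((Matrix.finite_real_spectrum.image _).continuousOn _) hsa)
    exact cfc_congr fun z _ => by simp [Real.exp_neg]
  · have hH := posDef_half_smul_add (posDef_matPow hA (-p)) (posDef_matPow hB (-p))
    rw [matPow_inv hA, matPow_inv hB]
    refine Eq.trans ?_ (inv_cfc hH.1 fun z hz =>
      (Real.rpow_pos_of_pos (spectrum_pos_of_posDef hH hz) (1 / p)).ne').symm
    refine cfc_congr fun z hz => ?_
    rw [← Real.rpow_neg (spectrum_pos_of_posDef hH hz).le, div_neg]

end FunctionalCalculus

/-! ### Duality between (p, q) and (-q, -p). -/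

open scoped Matrix.Norms.L2Operator in
theorem inv_le_inv_of_posDef {n : Type*} [Fintype n] [DecidableEq n] {A B : Matrix n n ℂ}
    (hA : A.PosDef) (hAB : A ≤ B) : B⁻¹ ≤ A⁻¹ := by
  rw [Matrix.nonsing_inv_eq_ringInverse, Matrix.nonsing_inv_eq_ringInverse]
  exact CStarAlgebra.ringInverse_le_ringInverse hAB hA.isStrictlyPositive

/-- The comparison `M_p ≤ M_q` is equivalent to `M_{-q} ≤ M_{-p}`. -/
theorem powerMean_le_powerMean_neg {n : Type*} [Fintype n] [DecidableEq n] {p q : ℝ}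
    (h : ∀ A B : Matrix n n ℂ, A.PosDef → B.PosDef → powerMean p A B ≤ powerMean q A B)
    (A B : Matrix n n ℂ) (hA : A.PosDef) (hB : B.PosDef) :
    powerMean (-q) A B ≤ powerMean (-p) A B := by
  rw [powerMean_neg hA hB, powerMean_neg hA hB]
  exact inv_le_inv_of_posDef (posDef_powerMean hA.inv hB.inv p) (h _ _ hA.inv hB.inv)

/-! ### Real 2 × 2 matrices in Bloch coordinates. -/

/-- The traceless real symmetric matrix `!![a, b; b, -a]`. -/
noncomputable def tracelessMat (a b : ℝ) : Matrix (Fin 2) (Fin 2) ℂ := !![(a : ℂ), b; b, -a]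

theorem isHermitian_tracelessMat (a b : ℝ) : (tracelessMat a b).IsHermitian := by
  ext i j
  fin_cases i <;> fin_cases j <;> simp [tracelessMat]

theorem tracelessMat_mul_self {a b : ℝ} (h : a ^ 2 + b ^ 2 = 1) :
    tracelessMat a b * tracelessMat a b = 1 := by
  have h' : (a : ℂ) * a + b * b = 1 := by exact_mod_cast (by linear_combination h : a * a + b * b = 1)
  ext i j
  fin_cases i <;> fin_cases j <;>
    simp [tracelessMat, Matrix.mul_apply, Fin.sum_univ_two, h', mul_comm] <;>
    linear_combination h'

theorem smul_tracelessMat_add (X Y a b c d : ℝ) :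
    X • tracelessMat a b + Y • tracelessMat c d =
      tracelessMat (X * a + Y * c) (X * b + Y * d) := by
  ext i j
  fin_cases i <;> fin_cases j <;> simp [tracelessMat] <;> ring

theorem smul_tracelessMat (X a b : ℝ) :
    X • tracelessMat a b = tracelessMat (X * a) (X * b) := by
  simpa using smul_tracelessMat_add X 0 a b 0 0

/-- Comparing the states of two ordered matrices at the pure state with Bloch vector `(u, v)`. -/
theorem le_of_tracelessMat_le {α β γ δ m n k l u v : ℝ} (huv : u ^ 2 + v ^ 2 = 1)
    (h : α • (1 : Matrix (Fin 2) (Fin 2) ℂ) + β • tracelessMat m n ≤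
      γ • (1 : Matrix (Fin 2) (Fin 2) ℂ) + δ • tracelessMat k l) :
    α + β * (m * u + n * v) ≤ γ + δ * (k * u + l * v) := by
  have h1 := ((Matrix.le_iff.mp h).conjTranspose_mul_mul_same
    (1 + tracelessMat u v)).trace_nonneg
  -- For a unit vector (u, v), `1 + tracelessMat u v` is twice a rank-one projection, whence the
  -- factor 4.
  have h2 : Matrix.trace ((1 + tracelessMat u v).conjTranspose *
      (γ • (1 : Matrix (Fin 2) (Fin 2) ℂ) + δ • tracelessMat k l -
        (α • (1 : Matrix (Fin 2) (Fin 2) ℂ) + β • tracelessMat m n)) * (1 + tracelessMat u v)) =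
      ((4 * (γ + δ * (k * u + l * v) - (α + β * (m * u + n * v))) : ℝ) : ℂ) := by
    have huv' : (u : ℂ) ^ 2 + v ^ 2 = 1 := by exact_mod_cast huv
    simp only [tracelessMat, Matrix.trace_fin_two, Matrix.mul_apply, Fin.sum_univ_two]
    simp
    linear_combination (2 * ((γ : ℂ) - α)) * huv'
  rw [h2] at h1
  have h3 : (0 : ℝ) ≤ 4 * (γ + δ * (k * u + l * v) - (α + β * (m * u + n * v))) := by
    exact_mod_cast h1
  linarith

/-- The real symmetric matrix with eigenvalue `1` at the state with Bloch vector `(a, b)`, and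
eigenvalue `x` at the orthogonal state. -/
noncomputable def eigenMat (x a b : ℝ) : Matrix (Fin 2) (Fin 2) ℂ :=
  ((1 + x) / 2) • (1 : Matrix (Fin 2) (Fin 2) ℂ) + ((1 - x) / 2) • tracelessMat a b

theorem posDef_eigenMat {x a b : ℝ} (hx : 1 < x) (h : a ^ 2 + b ^ 2 = 1) :
    (eigenMat x a b).PosDef := by
  set N : Matrix (Fin 2) (Fin 2) ℂ := 1 - tracelessMat a b with hN
  have hNH : N.conjTranspose = N := by
    rw [hN, Matrix.conjTranspose_sub, Matrix.conjTranspose_one, (isHermitian_tracelessMat a b).eq]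
  have hNN : N.conjTranspose * N = (2 : ℝ) • N := by
    rw [hNH, hN, mul_sub, sub_mul, sub_mul, tracelessMat_mul_self h, two_smul]
    simp; abel
  have hps : (((x - 1) / 4) • ((2 : ℝ) • N)).PosSemidef := by
    rw [← hNN]
    exact (Matrix.posSemidef_conjTranspose_mul_self N).smul (by linarith)
  have : eigenMat x a b = 1 + ((x - 1) / 4) • ((2 : ℝ) • N) := by
    rw [eigenMat, hN, smul_smul, smul_sub]
    module
  rw [this]
  exact Matrix.PosDef.one.add_posSemidef hps

theorem cfc_eigenMat (f : ℝ → ℝ) (x : ℝ) {a b : ℝ} (h : a ^ 2 + b ^ 2 = 1) :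
    cfc f (eigenMat x a b) = ((f 1 + f x) / 2) • (1 : Matrix (Fin 2) (Fin 2) ℂ) +
      ((f 1 - f x) / 2) • tracelessMat a b := by
  rw [eigenMat, cfc_smul_one_add_smul_involution f (isHermitian_tracelessMat a b)
    (tracelessMat_mul_self h)]
  ring_nf

/-! ### Means in Box–Cox coordinates: 1 goes to 0, the transform increases for every q, and q = 0
fits in. -/

/-- The Box–Cox transform `(t ^ q - 1) / q`, equal to `log t` for `q = 0`. -/
noncomputable def boxCox (q t : ℝ) : ℝ := if q = 0 then Real.log t else (t ^ q - 1) / q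

/-- The inverse of the Box–Cox transform. -/
noncomputable def boxCoxInv (q z : ℝ) : ℝ :=
  if q = 0 then Real.exp z else (1 + q * z) ^ (1 / q)

/-- The transforms of the two matrices are X(1 - a)/2 and Y(1 - b)/2, with a, b the involutions of
their Bloch vectors. Their average has scalar part (X + Y)/4 and traceless part -(Xa + Yb)/4; for r
≥ 0 the lower eigenvalue therefore sits at (m, n). -/
theorem powerMean_eigenMat (q x y : ℝ) {a b c d m n r : ℝ}
    (hab : a ^ 2 + b ^ 2 = 1) (hcd : c ^ 2 + d ^ 2 = 1) (hmn : m ^ 2 + n ^ 2 = 1)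
    (hm : boxCox q x * a + boxCox q y * c = 4 * r * m)
    (hn : boxCox q x * b + boxCox q y * d = 4 * r * n) :
    powerMean q (eigenMat x a b) (eigenMat y c d) =
      ((boxCoxInv q ((boxCox q x + boxCox q y) / 4 - r) +
        boxCoxInv q ((boxCox q x + boxCox q y) / 4 + r)) / 2) • (1 : Matrix (Fin 2) (Fin 2) ℂ) +
      ((boxCoxInv q ((boxCox q x + boxCox q y) / 4 - r) -
        boxCoxInv q ((boxCox q x + boxCox q y) / 4 + r)) / 2) • tracelessMat m n := by
  have hS : boxCox q x • tracelessMat a b + boxCox q y • tracelessMat c d =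
      (4 * r) • tracelessMat m n := by
    rw [smul_tracelessMat_add, hm, hn, ← smul_tracelessMat]
  have key := fun (f : ℝ → ℝ) t s => cfc_smul_one_add_smul_involution f
    (isHermitian_tracelessMat m n) (tracelessMat_mul_self hmn) t s
  unfold powerMean
  split_ifs with hq
  · subst hq
    simp only [boxCox, boxCoxInv, if_true] at hS ⊢
    have hH : (1 / 2 : ℝ) • (matLog (eigenMat x a b) + matLog (eigenMat y c d)) =
        ((Real.log x + Real.log y) / 4) • (1 : Matrix (Fin 2) (Fin 2) ℂ) +
          (-r) • tracelessMat m n := by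
      rw [matLog, matLog, cfc_eigenMat _ _ hab, cfc_eigenMat _ _ hcd, Real.log_one,
        show (-r) • tracelessMat m n = (-(1 / 4) : ℝ) • ((4 * r) • tracelessMat m n) by
          rw [smul_smul]; ring_nf, ← hS]
      module
    rw [hH, matExp, key]
    ring_nf
  · simp only [boxCox, boxCoxInv, if_neg hq] at hS ⊢
    have hH : (1 / 2 : ℝ) • (matPow (eigenMat x a b) q + matPow (eigenMat y c d) q) =
        (1 + q * (((x ^ q - 1) / q + (y ^ q - 1) / q) / 4)) • (1 : Matrix (Fin 2) (Fin 2) ℂ) +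
          (-q * r) • tracelessMat m n := by
      rw [matPow, matPow, cfc_eigenMat _ _ hab, cfc_eigenMat _ _ hcd, Real.one_rpow,
        show (-q * r) • tracelessMat m n = (-(q / 4) : ℝ) • ((4 * r) • tracelessMat m n) by
          rw [smul_smul]; ring_nf, ← hS]
      match_scalars <;> field_simp <;> ring
    rw [hH, matPow, key]
    ring_nf

open Filter Topology

theorem boxCox_one (q : ℝ) : boxCox q 1 = 0 := by
  unfold boxCox; split_ifs <;> simp

theorem boxCoxInv_zero (q : ℝ) : boxCoxInv q 0 = 1 := by
  unfold boxCoxInv; split_ifs <;> simp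

theorem boxCox_lt_boxCox (q : ℝ) {s t : ℝ} (hs : 0 < s) (hst : s < t) :
    boxCox q s < boxCox q t := by
  unfold boxCox
  split_ifs with hq
  · exact Real.log_lt_log hs hst
  · rcases lt_or_gt_of_ne hq with h | h
    · rw [div_lt_div_right_of_neg h]
      linarith [Real.rpow_lt_rpow_of_neg hs hst h]
    · rw [div_lt_div_iff_of_pos_right h]
      linarith [Real.rpow_lt_rpow hs.le hst h]

theorem boxCox_pos (q : ℝ) {t : ℝ} (ht : 1 < t) : 0 < boxCox q t := by
  simpa [boxCox_one] using boxCox_lt_boxCox q one_pos ht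

theorem one_add_mul_boxCox_pos (q : ℝ) {t : ℝ} (ht : 0 < t) : 0 < 1 + q * boxCox q t := by
  unfold boxCox
  split_ifs with hq
  · simp [hq]
  · rw [mul_div_cancel₀ _ hq]
    linarith [Real.rpow_pos_of_pos ht q]

theorem boxCoxInv_boxCox (q : ℝ) {t : ℝ} (ht : 0 < t) : boxCoxInv q (boxCox q t) = t := by
  unfold boxCox boxCoxInv
  split_ifs with hq
  · exact Real.exp_log ht
  · rw [mul_div_cancel₀ _ hq, add_sub_cancel, ← Real.rpow_mul ht.le, mul_one_div_cancel hq,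
      Real.rpow_one]

theorem boxCoxInv_le_boxCoxInv (q : ℝ) {s t : ℝ} (hs : 0 < 1 + q * s) (ht : 0 < 1 + q * t)
    (hst : s ≤ t) : boxCoxInv q s ≤ boxCoxInv q t := by
  unfold boxCoxInv
  split_ifs with hq
  · exact Real.exp_le_exp.mpr hst
  · rcases lt_or_gt_of_ne hq with h | h
    · exact Real.rpow_le_rpow_of_nonpos ht (by nlinarith) (one_div_neg.mpr h).le
    · exact Real.rpow_le_rpow hs.le (by nlinarith) (one_div_pos.mpr h).le

theorem hasDerivAt_boxCoxInv_zero (q : ℝ) : HasDerivAt (boxCoxInv q) 1 0 := by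
  by_cases hq : q = 0
  · have : boxCoxInv q = Real.exp := by ext z; simp [boxCoxInv, hq]
    rw [this]
    simpa using Real.hasDerivAt_exp 0
  · have : boxCoxInv q = fun z => (1 + q * z) ^ (1 / q) := by ext z; simp [boxCoxInv, hq]
    rw [this]
    have h1 : HasDerivAt (fun z : ℝ => 1 + q * z) q 0 := by
      simpa using ((hasDerivAt_id (0 : ℝ)).const_mul q).const_add 1
    have h2 := h1.rpow_const (p := 1 / q) (Or.inl (by simp))
    simpa [hq] using h2

/-- The derivative at 0 is 1; the slope 2 is slack, harmless because only growth rates in y matter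
later. -/
theorem exists_boxCoxInv_le (q : ℝ) :
    ∃ δ > 0, ∀ z, 0 < z → z ≤ δ → boxCoxInv q z ≤ 1 + 2 * z := by
  have h := hasDerivAt_iff_tendsto_slope.mp (hasDerivAt_boxCoxInv_zero q)
  have h1 : ∀ᶠ z in 𝓝[>] (0 : ℝ), slope (boxCoxInv q) 0 z < 2 :=
    (h.mono_left (nhdsWithin_mono _ fun z hz => ne_of_gt hz)).eventually_lt_const (by norm_num)
  obtain ⟨δ, hδ, hδ'⟩ := (mem_nhdsGT_iff_exists_Ioc_subset).mp h1
  refine ⟨δ, hδ, fun z hz hzδ => ?_⟩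
  have h2 : slope (boxCoxInv q) 0 z < 2 := hδ' ⟨hz, hzδ⟩
  rw [slope_def_field, boxCoxInv_zero, sub_zero, div_lt_iff₀ hz] at h2
  linarith

/-! ### Plane geometry of weighted sums of unit vectors. -/

theorem sq_cross_le {m n k l : ℝ} (h1 : m ^ 2 + n ^ 2 = 1) (h2 : k ^ 2 + l ^ 2 = 1) :
    (m * l - n * k) ^ 2 ≤ 2 * (1 - (m * k + n * l)) := by
  have : (m * l - n * k) ^ 2 + (m * k + n * l) ^ 2 = 1 := by
    linear_combination (k ^ 2 + l ^ 2) * h1 + h2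
  nlinarith [sq_nonneg (1 - (m * k + n * l))]

/-- The length of `X • u + Y • v` for unit vectors `u`, `v` of inner product `1 - ε`. -/
noncomputable def combNorm (X Y ε : ℝ) : ℝ := √((X + Y) ^ 2 - 2 * X * Y * ε)

section combNorm

variable {X Y ε : ℝ}

theorem sq_combNorm_aux (hX : 0 < X) (hY : 0 < Y) (h1 : ε ≤ 1) :
    X ^ 2 + Y ^ 2 ≤ (X + Y) ^ 2 - 2 * X * Y * ε := by
  nlinarith [mul_pos hX hY]

theorem sq_combNorm (hX : 0 < X) (hY : 0 < Y) (h1 : ε ≤ 1) :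
    combNorm X Y ε ^ 2 = (X + Y) ^ 2 - 2 * X * Y * ε :=
  Real.sq_sqrt (by nlinarith [sq_combNorm_aux hX hY h1])

theorem combNorm_pos (hX : 0 < X) (hY : 0 < Y) (h1 : ε ≤ 1) : 0 < combNorm X Y ε :=
  Real.sqrt_pos.mpr (by nlinarith [sq_combNorm_aux hX hY h1])

theorem combNorm_lt_add (hX : 0 < X) (hY : 0 < Y) (h0 : 0 < ε) : combNorm X Y ε < X + Y := by
  rw [combNorm, Real.sqrt_lt' (by positivity)]
  nlinarith [mul_pos (mul_pos hX hY) h0]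

theorem le_combNorm (hX : 0 < X) (hY : 0 < Y) (h1 : ε ≤ 1) : X ≤ combNorm X Y ε := by
  refine Real.le_sqrt_of_sq_le ?_
  nlinarith [sq_combNorm_aux hX hY h1]

/-- (X + Y)² - ρ² = 2XYε, and X + Y + ρ ≥ 2X. This bounds the lowest eigenvalue of the q-mean. -/
theorem add_sub_combNorm_le (hX : 0 < X) (hY : 0 < Y) (h0 : 0 < ε) (h1 : ε ≤ 1) :
    X + Y - combNorm X Y ε ≤ Y * ε := by
  have hs := sq_combNorm hX hY h1
  have hle := le_combNorm hX hY h1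
  have hlt := combNorm_lt_add hX hY h0
  have h2 : (X + Y - combNorm X Y ε) * (X + Y + combNorm X Y ε) = 2 * X * Y * ε := by
    linear_combination -hs
  by_contra hcon
  have h3 : Y * ε < X + Y - combNorm X Y ε := not_le.mp hcon
  nlinarith [mul_pos hY h0]

/-- Equivalently Y ≤ (X + Y + ρ)/4, so the top eigenvalue of the p-mean is at least y. -/
theorem three_mul_sub_le_combNorm (hY : 0 < Y) (hε : ε * X ≤ 4 * (X - Y)) :
    3 * Y - X ≤ combNorm X Y ε := by
  refine Real.le_sqrt_of_sq_le ?_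
  nlinarith [mul_le_mul_of_nonneg_left hε hY.le]

/-- The sine of the angle between the two sums is k(XY' - X'Y)/(ρρ') up to sign; use k² ≥ ε and ρ <
X + Y. -/
theorem exists_unit_vectors {X' Y' k : ℝ} (hX : 0 < X) (hY : 0 < Y) (hX' : 0 < X') (hY' : 0 < Y')
    (h0 : 0 < ε) (h1 : ε ≤ 1) (hk : k ^ 2 = ε * (2 - ε)) :
    ∃ m n u v : ℝ, m ^ 2 + n ^ 2 = 1 ∧ u ^ 2 + v ^ 2 = 1 ∧
      X + Y * (1 - ε) = combNorm X Y ε * m ∧ Y * k = combNorm X Y ε * n ∧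
      X' + Y' * (1 - ε) = combNorm X' Y' ε * u ∧ Y' * k = combNorm X' Y' ε * v ∧
      ε * (Y / (X + Y) - Y' / (X' + Y')) ^ 2 ≤ (m * v - n * u) ^ 2 := by
  have hρ := combNorm_pos hX hY h1
  have hρ' := combNorm_pos hX' hY' h1
  have hs := sq_combNorm hX hY h1
  have hs' := sq_combNorm hX' hY' h1
  have hlt := combNorm_lt_add hX hY h0
  have hlt' := combNorm_lt_add hX' hY' h0
  set ρ := combNorm X Y ε
  set ρ' := combNorm X' Y' ε
  refine ⟨(X + Y * (1 - ε)) / ρ, Y * k / ρ, (X' + Y' * (1 - ε)) / ρ', Y' * k / ρ', ?_, ?_,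
    (mul_div_cancel₀ _ hρ.ne').symm, (mul_div_cancel₀ _ hρ.ne').symm,
    (mul_div_cancel₀ _ hρ'.ne').symm, (mul_div_cancel₀ _ hρ'.ne').symm, ?_⟩
  · rw [div_pow, div_pow, ← add_div, div_eq_one_iff_eq (by positivity), hs, mul_pow, hk]
    ring
  · rw [div_pow, div_pow, ← add_div, div_eq_one_iff_eq (by positivity), hs', mul_pow, hk]
    ring
  · have e1 : (X + Y * (1 - ε)) / ρ * (Y' * k / ρ') - Y * k / ρ * ((X' + Y' * (1 - ε)) / ρ') =
        k * (X * Y' - X' * Y) / (ρ * ρ') := by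
      field_simp; ring
    have e2 : Y / (X + Y) - Y' / (X' + Y') = -(X * Y' - X' * Y) / ((X + Y) * (X' + Y')) := by
      field_simp; ring
    rw [e1, e2, div_pow, div_pow, mul_pow k, hk, neg_sq, ← mul_div_assoc]
    have hε : ε ≤ ε * (2 - ε) := by nlinarith
    gcongr
    rw [← hk]
    positivity

end combNorm

/-! ### The first-order obstruction. -/

theorem one_add_le_of_mix {a b c y : ℝ} (ha : 1 ≤ a) (hb : y ≤ b) (h1 : -1 ≤ c) (h2 : c ≤ 1) :
    1 + (y - 1) * (1 - c) / 2 ≤ (a + b) / 2 + (a - b) / 2 * c := by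
  linarith [mul_nonneg (sub_nonneg.mpr ha) (by linarith : 0 ≤ 1 + c),
    mul_nonneg (sub_nonneg.mpr hb) (sub_nonneg.mpr h2)]

/-- If `M_p ≤ M_q` for `2 × 2` matrices, the relative weights of `x` and `y` in the two means
differ by little. -/
theorem mul_sq_sub_le_of_powerMean_le {p q : ℝ}
    (h : ∀ A B : Matrix (Fin 2) (Fin 2) ℂ, A.PosDef → B.PosDef →
      powerMean p A B ≤ powerMean q A B) {x y : ℝ} (hy : 1 < y) (hyx : y < x) :
    (y - 1) * (boxCox p y / (boxCox p x + boxCox p y) -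
      boxCox q y / (boxCox q x + boxCox q y)) ^ 2 ≤ 2 * boxCox q y := by
  have hx : 1 < x := hy.trans hyx
  obtain ⟨δ, hδ, hG⟩ := exists_boxCoxInv_le q
  have hXp := boxCox_pos p hx
  have hYp := boxCox_pos p hy
  have hXq := boxCox_pos q hx
  have hYq := boxCox_pos q hy
  have hXYp := boxCox_lt_boxCox p (one_pos.trans hy) hyx
  have hdomX := one_add_mul_boxCox_pos p (one_pos.trans hx)
  have hdomY := one_add_mul_boxCox_pos p (one_pos.trans hy)
  have hGY := boxCoxInv_boxCox p (one_pos.trans hy)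
  have hmeans := fun a b c d hab hcd =>
    h (eigenMat x a b) (eigenMat y c d) (posDef_eigenMat hx hab) (posDef_eigenMat hy hcd)
  have hMp := fun a b c d m n r => powerMean_eigenMat p x y (a := a) (b := b) (c := c) (d := d)
    (m := m) (n := n) (r := r)
  have hMq := fun a b c d m n r => powerMean_eigenMat q x y (a := a) (b := b) (c := c) (d := d)
    (m := m) (n := n) (r := r)
  set Xp := boxCox p x
  set Yp := boxCox p y
  set Xq := boxCox q x
  set Yq := boxCox q y
  -- The last two bounds keep the top eigenvalue of the p-mean above y and put the argument of
  -- `boxCoxInv q` in the range of the linear estimate.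
  obtain ⟨ε, hε0, hε1, hεp, hεq⟩ : ∃ ε : ℝ, 0 < ε ∧ ε ≤ 1 ∧ ε * Xp ≤ 4 * (Xp - Yp) ∧
      ε * Yq ≤ 4 * δ := by
    refine ⟨min 1 (min (4 * (Xp - Yp) / Xp) (4 * δ / Yq)), ?_, min_le_left _ _, ?_, ?_⟩
    · have : 0 < Xp - Yp := by linarith
      positivity
    · rw [← le_div_iff₀ hXp]
      exact (min_le_right _ _).trans (min_le_left _ _)
    · rw [← le_div_iff₀ hYq]
      exact (min_le_right _ _).trans (min_le_right _ _)
  have hk : (√(ε * (2 - ε))) ^ 2 = ε * (2 - ε) := Real.sq_sqrt (by nlinarith)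
  set k := √(ε * (2 - ε))
  have hunit : (1 - ε) ^ 2 + k ^ 2 = 1 := by rw [hk]; ring
  have hltp := combNorm_lt_add hXp hYp hε0
  have hltq := combNorm_lt_add hXq hYq hε0
  have hgapq := add_sub_combNorm_le hXq hYq hε0 hε1
  have h3p := three_mul_sub_le_combNorm hYp hεp
  set ρp := combNorm Xp Yp ε
  set ρq := combNorm Xq Yq ε
  obtain ⟨m, n, u, v, hmn, huv, hm, hn, hu, hv, hsin⟩ :=
    exists_unit_vectors hXp hYp hXq hYq hε0 hε1 hk
  have hle := hmeans 1 0 (1 - ε) k (by norm_num) hunit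
  rw [hMp 1 0 (1 - ε) k m n (ρp / 4) (by norm_num) hunit hmn (by linarith)
      (by linarith),
    hMq 1 0 (1 - ε) k u v (ρq / 4) (by norm_num) hunit huv (by linarith)
      (by linarith)] at hle
  have hstate := le_of_tracelessMat_le huv hle
  have hG1q := hG ((Xq + Yq) / 4 - ρq / 4) (by linarith) (by linarith)
  -- An affine function positive at 0 and at Xp is positive between.
  have hdom : ∀ z, 0 ≤ z → z ≤ Xp → 0 < 1 + p * z := by
    intro z hz0 hzX
    rcases le_total 0 p with hp | hp
    · linarith [mul_nonneg hp hz0]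
    · linarith [mul_le_mul_of_nonpos_left hzX hp]
  have hG1p : 1 ≤ boxCoxInv p ((Xp + Yp) / 4 - ρp / 4) := by
    rw [← boxCoxInv_zero p]
    exact boxCoxInv_le_boxCoxInv p (by simp) (hdom _ (by linarith) (by linarith)) (by linarith)
  have hG2p : y ≤ boxCoxInv p ((Xp + Yp) / 4 + ρp / 4) := by
    rw [← hGY]
    exact boxCoxInv_le_boxCoxInv p hdomY (hdom _ (by linarith) (by linarith)) (by linarith)
  have hcross := sq_cross_le hmn huv
  have hcos : m * u + n * v ≤ 1 := by linarith only [sq_nonneg (m * v - n * u), hcross]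
  have hcos' : -1 ≤ m * u + n * v := by
    linarith only [sq_nonneg (m + u), sq_nonneg (n + v), hmn, huv]
  set D := (Yp / (Xp + Yp) - Yq / (Xq + Yq)) ^ 2
  have huv' : u * u + v * v = 1 := by linear_combination huv
  rw [huv'] at hstate
  have hc := hsin.trans hcross
  generalize m * u + n * v = c at hstate hcos hcos' hc
  have h4 := one_add_le_of_mix hG1p hG2p hcos' hcos
  have h5 : (y - 1) * (ε * D) ≤ (y - 1) * (2 * (1 - c)) :=
    mul_le_mul_of_nonneg_left hc (by linarith)
  refine le_of_mul_le_mul_left ?_ hε0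
  calc ε * ((y - 1) * D) = (y - 1) * (ε * D) := by ring
    _ ≤ (y - 1) * (2 * (1 - c)) := h5
    _ ≤ ε * (2 * Yq) := by linarith

/-! ### Asymptotics of the weights. -/

/-- The relative weight of `y` in the Box–Cox transforms of `x` and `y`. -/
noncomputable def boxCoxWeight (p x y : ℝ) : ℝ := boxCox p y / (boxCox p x + boxCox p y)

theorem tendsto_boxCox_of_neg {p : ℝ} (hp : p < 0) : Tendsto (boxCox p) atTop (𝓝 (-1 / p)) := by
  have h : boxCox p = fun t => (t ^ p - 1) / p := by ext t; simp [boxCox, hp.ne]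
  rw [h]
  have h1 : Tendsto (fun t : ℝ => t ^ p) atTop (𝓝 0) := by
    simpa using tendsto_rpow_neg_atTop (neg_pos.mpr hp)
  simpa using (h1.sub_const 1).div_const p

theorem tendsto_boxCoxWeight_of_neg {p : ℝ} (hp : p < 0) {g : ℝ → ℝ} (hg : Tendsto g atTop atTop) :
    Tendsto (fun y => boxCoxWeight p (g y) y) atTop (𝓝 (1 / 2)) := by
  have h1 := tendsto_boxCox_of_neg hp
  have h2 := h1.comp hg
  have hne : -1 / p + -1 / p ≠ 0 := by
    have : 0 < -1 / p := div_pos_of_neg_of_neg (by norm_num) hp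
    positivity
  have h3 := h1.div (h2.add h1) hne
  have h4 : -1 / p / (-1 / p + -1 / p) = 1 / 2 := by
    have := hp.ne
    field_simp
    norm_num
  rw [h4] at h3
  exact h3

theorem tendsto_boxCoxWeight_two_mul_of_pos {p : ℝ} (hp : 0 < p) :
    Tendsto (fun y => boxCoxWeight p (2 * y) y) atTop (𝓝 (1 / (2 ^ p + 1))) := by
  have h1 : Tendsto (fun y : ℝ => y ^ (-p)) atTop (𝓝 0) := tendsto_rpow_neg_atTop hp
  have h2 : (0 : ℝ) < 2 ^ p := Real.rpow_pos_of_pos two_pos p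
  have h3 : Tendsto (fun y : ℝ => (1 - y ^ (-p)) / (2 ^ p + 1 - 2 * y ^ (-p))) atTop
      (𝓝 ((1 - 0) / (2 ^ p + 1 - 2 * 0))) :=
    (h1.const_sub 1).div ((h1.const_mul 2).const_sub _) (by linarith)
  simp only [sub_zero, mul_zero] at h3
  refine h3.congr' ?_
  filter_upwards [eventually_gt_atTop 1] with y hy
  have hy0 : 0 < y := one_pos.trans hy
  have hyp : (1 : ℝ) < y ^ p := Real.one_lt_rpow hy hp
  have h4 : (1 : ℝ) < (2 * y) ^ p := Real.one_lt_rpow (by linarith) hp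
  have h5 := Real.mul_rpow (x := 2) (y := y) (z := p) two_pos.le hy0.le
  rw [h5] at h4
  simp only [boxCoxWeight, boxCox, if_neg hp.ne']
  rw [Real.rpow_neg hy0.le, h5]
  have h6 : (2 : ℝ) ^ p + 1 - 2 * (y ^ p)⁻¹ ≠ 0 := by
    have : (2 : ℝ) ^ p + 1 - 2 * (y ^ p)⁻¹ = (2 ^ p * y ^ p - 1 + (y ^ p - 1)) / y ^ p := by
      field_simp; ring
    rw [this]
    exact (div_pos (by linarith) (by linarith)).ne'
  have h7 : (2 : ℝ) ^ p * y ^ p - 1 + (y ^ p - 1) ≠ 0 := by linarith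
  rw [← add_div, div_div_div_cancel_right₀ hp.ne', div_eq_div_iff h6 h7]
  have h8 : y ^ p ≠ 0 := by linarith
  field_simp
  ring

/-- The deviation is (X - Y)/(2(X + Y)), where X - Y is exactly y^p (2^p - 1)/p and X + Y → -2/p. -/
theorem tendsto_rpow_mul_half_sub_boxCoxWeight {p : ℝ} (hp : p < 0) :
    Tendsto (fun y => y ^ (-p) * (1 / 2 - boxCoxWeight p (2 * y) y)) atTop
      (𝓝 ((1 - 2 ^ p) / 4)) := by
  have h1 := tendsto_boxCox_of_neg hp
  have h2 := h1.comp (tendsto_id.const_mul_atTop (two_pos (α := ℝ)))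
  have hne : 2 * (-1 / p + -1 / p) ≠ 0 := by
    have : 0 < -1 / p := div_pos_of_neg_of_neg (by norm_num) hp
    positivity
  have h3 := (tendsto_const_nhds (x := ((2 : ℝ) ^ p - 1) / p)).div ((h2.add h1).const_mul 2) hne
  have h4 : ((2 : ℝ) ^ p - 1) / p / (2 * (-1 / p + -1 / p)) = (1 - 2 ^ p) / 4 := by
    have := hp.ne
    field_simp
    ring
  rw [h4] at h3
  refine h3.congr' ?_
  filter_upwards [eventually_gt_atTop 1] with y hy
  have hy0 : 0 < y := one_pos.trans hy
  have hX := boxCox_pos p (show 1 < 2 * y by linarith)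
  have hY := boxCox_pos p hy
  have h5 : boxCox p (2 * y) - boxCox p y = y ^ p * ((2 ^ p - 1) / p) := by
    simp only [boxCox, if_neg hp.ne]
    rw [Real.mul_rpow two_pos.le hy0.le]
    ring
  have h6 : 1 / 2 - boxCoxWeight p (2 * y) y =
      (boxCox p (2 * y) - boxCox p y) / (2 * (boxCox p (2 * y) + boxCox p y)) := by
    rw [boxCoxWeight]
    field_simp
    ring
  have h7 : y ^ (-p) * y ^ p = 1 := by rw [← Real.rpow_add hy0]; simp
  rw [h6, h5, mul_div_assoc', ← mul_assoc, h7, one_mul]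
  rfl

theorem tendsto_boxCox_div_self {q : ℝ} (h0 : 0 ≤ q) (h1 : q < 1) :
    Tendsto (fun y => boxCox q y / y) atTop (𝓝 0) := by
  rcases h0.eq_or_lt with rfl | h0
  · simpa [boxCox] using Real.isLittleO_log_id_atTop.tendsto_div_nhds_zero
  · have h2 : Tendsto (fun y : ℝ => y ^ (-(1 - q))) atTop (𝓝 0) :=
      tendsto_rpow_neg_atTop (by linarith)
    have h3 := (h2.sub tendsto_inv_atTop_zero).div_const q
    simp only [sub_zero, zero_div] at h3
    refine h3.congr' ?_
    filter_upwards [eventually_gt_atTop 0] with y hy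
    rw [boxCox, if_neg h0.ne', neg_sub, Real.rpow_sub_one hy.ne']
    ring

theorem tendsto_one_sub_inv : Tendsto (fun y : ℝ => 1 - y⁻¹) atTop (𝓝 1) := by
  simpa using tendsto_inv_atTop_zero.const_sub (1 : ℝ)

/-! ### Excluded exponents and conclusion. -/

section Obstruction

variable {p q : ℝ} (h : ∀ A B : Matrix (Fin 2) (Fin 2) ℂ, A.PosDef → B.PosDef →
  powerMean p A B ≤ powerMean q A B)

include h

theorem limit_boxCoxWeight_eq (hq0 : 0 ≤ q) (hq1 : q < 1) {g : ℝ → ℝ} (hg : ∀ y, 1 < y → y < g y)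
    {a b : ℝ} (ha : Tendsto (fun y => boxCoxWeight p (g y) y) atTop (𝓝 a))
    (hb : Tendsto (fun y => boxCoxWeight q (g y) y) atTop (𝓝 b)) : a = b := by
  have h1 := tendsto_one_sub_inv.mul ((ha.sub hb).pow 2)
  have h2 := (tendsto_boxCox_div_self hq0 hq1).const_mul 2
  have h3 : 1 * (a - b) ^ 2 ≤ 2 * 0 := by
    refine le_of_tendsto_of_tendsto h1 h2 ?_
    filter_upwards [eventually_gt_atTop 1] with y hy
    have hy0 : 0 < y := one_pos.trans hy
    have h4 := mul_sq_sub_le_of_powerMean_le h hy (hg y hy)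
    rw [← mul_div_assoc, le_div_iff₀ hy0]
    calc _ = (y - 1) * (boxCoxWeight p (g y) y - boxCoxWeight q (g y) y) ^ 2 := by field_simp
      _ ≤ _ := h4
  have h4 : (a - b) ^ 2 = 0 := le_antisymm (by linarith) (sq_nonneg _)
  exact sub_eq_zero.mp (pow_eq_zero_iff two_ne_zero |>.mp h4)

theorem false_of_powerMean_le_of_pos (hpq : p < q) (hp : p ≠ 0) (hq0 : 0 < q) (hq1 : q < 1) :
    False := by
  have hb := tendsto_boxCoxWeight_two_mul_of_pos hq0
  rcases lt_or_gt_of_ne hp with hp | hp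
  · have ha := tendsto_boxCoxWeight_of_neg hp (tendsto_id.const_mul_atTop (two_pos (α := ℝ)))
    have := limit_boxCoxWeight_eq h hq0.le hq1 (fun y hy => by simp; linarith) ha hb
    have h2 : (1 : ℝ) < 2 ^ q := Real.one_lt_rpow one_lt_two hq0
    rw [div_eq_div_iff (by norm_num) (by linarith)] at this
    linarith
  · have ha := tendsto_boxCoxWeight_two_mul_of_pos hp
    have := limit_boxCoxWeight_eq h hq0.le hq1 (fun y hy => by linarith) ha hb
    have h2 : (2 : ℝ) ^ p < 2 ^ q := Real.rpow_lt_rpow_of_exponent_lt one_lt_two hpq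
    have h3 : (0 : ℝ) < 2 ^ p := Real.rpow_pos_of_pos two_pos p
    rw [div_eq_div_iff (by linarith) (by linarith)] at this
    linarith

theorem false_of_powerMean_le_of_eq_zero (hp : p < 0) (hq : q = 0) : False := by
  subst hq
  -- With x = 2y the logarithmic weight would also tend to 1/2; x = y² keeps it at 1/3.
  have ha := tendsto_boxCoxWeight_of_neg hp (tendsto_pow_atTop (α := ℝ) two_ne_zero)
  have hb : Tendsto (fun y : ℝ => boxCoxWeight 0 (y ^ 2) y) atTop (𝓝 (1 / 3)) := by
    refine tendsto_const_nhds.congr' ?_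
    filter_upwards [eventually_gt_atTop 1] with y hy
    have := Real.log_pos hy
    simp only [boxCoxWeight, boxCox, if_true, Real.log_pow]
    push_cast
    field_simp
    norm_num
  have := limit_boxCoxWeight_eq h le_rfl one_pos (fun y hy => by nlinarith) ha hb
  norm_num at this

theorem false_of_powerMean_le_of_neg (hpq : p < q) (hq0 : q < 0) (hq1 : -(1 / 2) < q) : False := by
  -- As p < q, the p-deviation is negligible at scale y^q, so w_p - w_q has exact order y^q.
  have ha := (tendsto_rpow_neg_atTop (sub_pos.mpr hpq)).mul
    (tendsto_rpow_mul_half_sub_boxCoxWeight (hpq.trans hq0))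
  have hb := tendsto_rpow_mul_half_sub_boxCoxWeight hq0
  have hlim := tendsto_one_sub_inv.mul ((hb.sub ha).pow 2)
  have h2 : (2 : ℝ) ^ q < 1 := Real.rpow_lt_one_of_one_lt_of_neg one_lt_two hq0
  have hpos : 0 < 1 * ((1 - (2 : ℝ) ^ q) / 4 - 0 * ((1 - 2 ^ p) / 4)) ^ 2 := by
    have : 0 < 1 - (2 : ℝ) ^ q := by linarith
    simp only [zero_mul, sub_zero, one_mul]
    positivity
  have htop := (tendsto_rpow_atTop (show 0 < 1 + 2 * q by linarith)).atTop_mul_pos hpos hlim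
  obtain ⟨y, hy, hy1⟩ := ((htop.eventually_gt_atTop (-2 / q)).and (eventually_gt_atTop 1)).exists
  have hy0 : 0 < y := one_pos.trans hy1
  have h4 := mul_sq_sub_le_of_powerMean_le h hy1 (show y < 2 * y by linarith)
  have h5 : boxCox q y ≤ -1 / q := by
    rw [boxCox, if_neg hq0.ne, div_le_div_right_of_neg hq0]
    linarith [Real.rpow_pos_of_pos hy0 q]
  have e1 : y ^ (-(q - p)) * (y ^ (-p) * (1 / 2 - boxCoxWeight p (2 * y) y)) =
      y ^ (-q) * (1 / 2 - boxCoxWeight p (2 * y) y) := by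
    rw [← mul_assoc, ← Real.rpow_add hy0]
    ring_nf
  have e2 : y ^ (1 + 2 * q) * (y ^ (-q)) ^ 2 = y := by
    rw [← Real.rpow_natCast, ← Real.rpow_mul hy0.le, ← Real.rpow_add hy0]
    norm_num
    ring_nf
    simp
  rw [e1, ← mul_sub, mul_pow, mul_left_comm (1 - y⁻¹), ← mul_assoc, e2, ← mul_assoc, mul_sub,
    mul_inv_cancel₀ hy0.ne', mul_one] at hy
  have h6 : -2 / q = 2 * (-1 / q) := by ring
  have h7 : (1 / 2 - boxCoxWeight q (2 * y) y - (1 / 2 - boxCoxWeight p (2 * y) y)) =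
    boxCoxWeight p (2 * y) y - boxCoxWeight q (2 * y) y := by ring
  rw [h7] at hy
  unfold boxCoxWeight at hy
  linarith

/-- The comparison of the means of two commuting matrices at a common eigenvector. -/
theorem boxCoxInv_half_add_le {x y : ℝ} (hx : 1 < x) (hy : 1 < y) :
    boxCoxInv p ((boxCox p x + boxCox p y) / 2) ≤
      boxCoxInv q ((boxCox q x + boxCox q y) / 2) := by
  have h1 := h (eigenMat x 1 0) (eigenMat y 1 0) (posDef_eigenMat hx (by norm_num))
    (posDef_eigenMat hy (by norm_num))
  rw [powerMean_eigenMat p x y (m := 1) (n := 0) (r := (boxCox p x + boxCox p y) / 4)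
      (by norm_num) (by norm_num) (by norm_num) (by ring) (by ring),
    powerMean_eigenMat q x y (m := 1) (n := 0) (r := (boxCox q x + boxCox q y) / 4)
      (by norm_num) (by norm_num) (by norm_num) (by ring) (by ring)] at h1
  -- The state (-1, 0) carries x and y; the opposite one has eigenvalue 1 in both matrices.
  have h2 := le_of_tracelessMat_le (u := -1) (v := 0) (by norm_num) h1
  ring_nf at h2 ⊢
  linarith

/-- The p-mean of 2 and y is at least y · 2^(-1/p). The q-mean is bounded for q < 0, is √(2y) for q
= 0, and is asymptotic to y · 2^(-1/q) for q > 0. -/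
theorem le_of_powerMean_le_of_pos (hp : 0 < p) : p ≤ q := by
  have hlow : ∀ y : ℝ, 1 < y → y * (1 / 2) ^ (1 / p) ≤
      boxCoxInv q ((boxCox q 2 + boxCox q y) / 2) := by
    intro y hy
    have hy0 : 0 < y := one_pos.trans hy
    refine le_trans ?_ (boxCoxInv_half_add_le h one_lt_two hy)
    have hyp := Real.rpow_pos_of_pos hy0 p
    have h2p := Real.rpow_pos_of_pos (two_pos (α := ℝ)) p
    have e : y * (1 / 2) ^ (1 / p) = (y ^ p * (1 / 2)) ^ (1 / p) := by
      rw [Real.mul_rpow hyp.le (by norm_num), ← Real.rpow_mul hy0.le, mul_one_div_cancel hp.ne',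
        Real.rpow_one]
    simp only [boxCox, boxCoxInv, if_neg hp.ne']
    rw [e]
    refine Real.rpow_le_rpow (by positivity) ?_ (by positivity)
    field_simp
    linarith
  have hc : (0 : ℝ) < (1 / 2) ^ (1 / p) := Real.rpow_pos_of_pos (by norm_num) _
  rcases lt_trichotomy q 0 with hq | hq | hq
  · exfalso
    obtain ⟨y, hy, hy1⟩ := (((tendsto_id (α := ℝ)).atTop_mul_const hc).eventually_gt_atTop
      ((2 ^ q / 2) ^ (1 / q)) |>.and (eventually_gt_atTop 1)).exists
    have hyq := Real.rpow_pos_of_pos (one_pos.trans hy1) q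
    have h2q := Real.rpow_pos_of_pos (two_pos (α := ℝ)) q
    have h3 := hlow y hy1
    simp only [boxCox, boxCoxInv, if_neg hq.ne] at h3
    have e : 1 + q * (((2 ^ q - 1) / q + (y ^ q - 1) / q) / 2) = (2 ^ q + y ^ q) / 2 := by
      have := hq.ne
      field_simp
      ring
    rw [e] at h3
    have h4 : ((2 ^ q + y ^ q) / 2) ^ (1 / q) ≤ ((2 : ℝ) ^ q / 2) ^ (1 / q) :=
      Real.rpow_le_rpow_of_nonpos (by positivity) (by linarith) (one_div_neg.mpr hq).le
    simp only [id] at hy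
    linarith
  · exfalso
    subst hq
    obtain ⟨y, hy, hy1⟩ := (((tendsto_id (α := ℝ)).atTop_mul_const
      (pow_pos hc 2)).eventually_gt_atTop 2 |>.and (eventually_gt_atTop 1)).exists
    have hy0 := one_pos.trans hy1
    have h3 := hlow y hy1
    simp only [boxCox, boxCoxInv, if_true] at h3
    have h4 := pow_le_pow_left₀ (by positivity) h3 2
    rw [← Real.exp_nat_mul] at h4
    push_cast at h4
    rw [mul_div_cancel₀ _ two_ne_zero, Real.exp_add, Real.exp_log two_pos, Real.exp_log hy0] at h4
    simp only [id] at hy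
    nlinarith
  · have h1 : Tendsto (fun y : ℝ => (((2 * y⁻¹) ^ q + 1) / 2) ^ (1 / q)) atTop
        (𝓝 ((((2 * 0) ^ q + 1) / 2 : ℝ) ^ (1 / q))) := by
      have h2 := (tendsto_inv_atTop_zero (𝕜 := ℝ)).const_mul 2
      have h3 := ((h2.rpow_const (p := q) (Or.inr hq.le)).add_const 1).div_const 2
      exact h3.rpow_const (Or.inr (by positivity))
    rw [mul_zero, Real.zero_rpow hq.ne', zero_add] at h1
    have h2 : ((1 : ℝ) / 2) ^ (1 / p) ≤ (1 / 2) ^ (1 / q) := by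
      refine ge_of_tendsto h1 ?_
      filter_upwards [eventually_gt_atTop 1] with y hy
      have hy0 : 0 < y := one_pos.trans hy
      have hyq := Real.rpow_pos_of_pos hy0 q
      have h3 := hlow y hy
      simp only [boxCox, boxCoxInv, if_neg hq.ne'] at h3
      have e : 1 + q * (((2 ^ q - 1) / q + (y ^ q - 1) / q) / 2) =
          y ^ q * (((2 * y⁻¹) ^ q + 1) / 2) := by
        rw [Real.mul_rpow two_pos.le (by positivity), Real.inv_rpow hy0.le]
        field_simp
        ring
      rw [e, Real.mul_rpow hyq.le (by positivity), ← Real.rpow_mul hy0.le,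
        mul_one_div_cancel hq.ne', Real.rpow_one] at h3
      exact le_of_mul_le_mul_left h3 hy0
    rw [Real.rpow_le_rpow_left_iff_of_base_lt_one (by norm_num) (by norm_num),
      one_div_le_one_div hq hp] at h2
    exact h2

theorem le_of_powerMean_le : p ≤ q := by
  rcases lt_or_ge 0 p with hp | hp
  · exact le_of_powerMean_le_of_pos h hp
  · by_contra! hqp
    have := le_of_powerMean_le_of_pos (powerMean_le_powerMean_neg h) (by linarith)
    linarith

theorem le_or_ge_of_powerMean_le (hpq : p < q) : q ≤ -1 / 2 ∨ 1 ≤ q := by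
  by_contra! hq
  rcases lt_trichotomy q 0 with hq0 | hq0 | hq0
  · exact false_of_powerMean_le_of_neg h hpq hq0 (by linarith)
  · exact false_of_powerMean_le_of_eq_zero h (hq0 ▸ hpq) hq0
  · rcases eq_or_ne p 0 with hp | hp
    · exact false_of_powerMean_le_of_eq_zero (powerMean_le_powerMean_neg h) (by linarith)
        (by simp [hp])
    · exact false_of_powerMean_le_of_pos h hpq hp hq0 hq.2

end Obstruction

theorem theorem2p3 (p q : ℝ)
    (h : ∀ A B : Matrix (Fin 2) (Fin 2) ℂ, A.PosDef → B.PosDef →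
      powerMean p A B ≤ powerMean q A B) :
    p = q ∨
    (1 ≤ p ∧ p < q) ∨
    (p < q ∧ q ≤ -1) ∨
    (p ≤ -1 ∧ 1 ≤ q) ∨
    (1 / 2 ≤ p ∧ p < 1 ∧ 1 ≤ q) ∨
    (p ≤ -1 ∧ -1 < q ∧ q ≤ -1 / 2) := by
  rcases (le_of_powerMean_le h).eq_or_lt with hpq | hpq
  · exact Or.inl hpq
  have hq := le_or_ge_of_powerMean_le h hpq
  have hp : 1 / 2 ≤ p ∨ p ≤ -1 := by
    rcases le_or_ge_of_powerMean_le (powerMean_le_powerMean_neg h) (neg_lt_neg hpq) with h1 | h1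
    · left; linarith
    · right; linarith
  grind
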